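/- Let $\mathcal P \subset \mathbb R^N$ be a convex polytope and let $\partial\mathcal P$ be its boundary relative to its affine span. An affine hyperplane $\mathcal H = \{x \in \mathbb R^N : h(x) = r\}$ (where $h$ is a nonzero real linear functional and $r \in \mathbb R$), with closed half-spaces $\mathcal H^{(+)} = \{h \ge r\}$ and $\mathcal H^{(-)} = \{h \le r\}$, is called a separating hyperplane of $\mathcal P$ if $\mathcal H \cap (\mathcal P \setminus \partial \mathcal P) \ne \emptyset$, $\mathcal P \not\subset \mathcal H$, and every vertex of $\mathcal P \cap \mathcal H^{(+)}$ and every vertex of $\mathcal P \cap \mathcal H^{(-)}$ is a vertex of $\mathcal P$. Theorem. For every $n$, the Birkhoff polytope $B_n \subset \mathbb R^{n \times n}$, i.e. the polytope of all $n \times n$ nonnegative real matrices whose row sums and column sums are all equal to $1$, has no separating hyperplane. -/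

import Mathlib

/-- A subset `H` of a real vector space `E` is a *separating hyperplane* of the convex polytope
`P ⊆ E` if it is an affine hyperplane `{x | f x = r}` with `f ≠ 0`, it meets `P \ ∂P` (the boundary
`∂P` being taken relative to the affine span of `P`), it does not contain `P`, and each vertex of
either of the polytopes `P ∩ H⁺`, `P ∩ H⁻` cut out by the two closed half-spaces is a vertex
of `P`. The vertices of a polytope are its extreme points. -/
def IsSeparatingHyperplane {E : Type*} [AddCommGroup E] [Module ℝ E] [TopologicalSpace E]
    (P H : Set E) : Prop :=
  ∃ (f : E →ₗ[ℝ] ℝ) (r : ℝ), f ≠ 0 ∧ H = {x | f x = r} ∧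
    (H ∩ (P \ intrinsicFrontier ℝ P)).Nonempty ∧
    ¬ P ⊆ H ∧
    (P ∩ {x | r ≤ f x}).extremePoints ℝ ⊆ P.extremePoints ℝ ∧
    (P ∩ {x | f x ≤ r}).extremePoints ℝ ⊆ P.extremePoints ℝ

/-- The Birkhoff polytope `B_n`: the set of real doubly stochastic `n × n` matrices, inside the
`n ^ 2`-dimensional real vector space of all `n × n` matrices. -/
def birkhoffPolytope (n : ℕ) : Set (Matrix (Fin n) (Fin n) ℝ) :=
  (doublyStochastic ℝ (Fin n) : Set (Matrix (Fin n) (Fin n) ℝ))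

/-! A hyperplane through the relative interior that does not contain the polytope has points of it,
hence by Birkhoff–von Neumann permutation matrices, strictly on both sides. When `σ⁻¹ * τ` is a
cycle, the two matrices span an edge; a strict crossing would be a new vertex, so no edge is
strictly crossed. Combinatorics finishes: take `σ` above and `τ` below with `σ⁻¹ * τ` of least
support. It is not a cycle, so two of its cycles give disjoint transpositions that move `σ` closer
to `τ`, hence to values at most `r`. Linear relations among permutation matrices exclude this. -/

open Equiv Equiv.Perm in
/-- For a linear functional on permutation matrices that is positive on the identity and such that no
segment joining two permutation matrices which differ by a cycle is crossed, two disjoint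
transpositions cannot both have nonpositive value. -/
theorem false_of_swap_le_of_disjoint {α : Type*} [Fintype α] [DecidableEq α] (M : α → α → ℝ) (r : ℝ)
    (h : ∀ σ τ : Perm α, (σ⁻¹ * τ).IsCycle → r < ∑ i, M i (σ i) → r ≤ ∑ i, M i (τ i))
    {a b c d : α} (hn : [a, b, c, d].Nodup) (h1 : r < ∑ i, M i i)
    (hab : ∑ i, M i (swap a b i) ≤ r) (hcd : ∑ i, M i (swap c d i) ≤ r) : False := by
  simp only [List.nodup_cons, List.mem_cons, List.not_mem_nil, or_false, not_or, not_false_eq_true,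
    List.nodup_nil, and_true] at hn
  obtain ⟨⟨nab, nac, nad⟩, ⟨nbc, nbd⟩, ncd⟩ := hn
  have hdisj : ∑ i, M i ((swap a b * swap c d) i) + ∑ i, M i i =
      ∑ i, M i (swap a b i) + ∑ i, M i (swap c d i) := by
    rw [← Finset.sum_add_distrib, ← Finset.sum_add_distrib]
    refine Finset.sum_congr rfl fun i _ => ?_
    simp only [Perm.mul_apply, swap_apply_def]
    grind
  -- The even and the odd permutations of `{a, b, c}` have the same matrix sum.
  have hthree : ∑ i, M i i + ∑ i, M i ((swap a b * swap a c) i) +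
        ∑ i, M i ((swap a c * swap a b) i) =
      ∑ i, M i (swap a b i) + ∑ i, M i (swap a c i) + ∑ i, M i (swap b c i) := by
    simp only [← Finset.sum_add_distrib]
    refine Finset.sum_congr rfl fun i _ => ?_
    simp only [Perm.mul_apply, swap_apply_def]
    grind
  have hpos : ∀ τ : Perm α, τ.IsCycle → r ≤ ∑ i, M i (τ i) := fun τ hτ =>
    h 1 τ (by simpa using hτ) (by simpa using h1)
  -- By `hdisj` the double transposition lies strictly below `r`, so its neighbours cannot lie
  -- above.
  have hneg : ∀ τ : Perm α, (τ⁻¹ * (swap a b * swap c d)).IsCycle → ∑ i, M i (τ i) ≤ r := by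
    intro τ hτ
    by_contra! hlt
    linarith [h τ _ hτ hlt]
  -- This is the 4-cycle `(x y c d)` conjugated by `swap x y`.
  have key : ∀ x y : α, [x, y, c, d].Nodup → (swap y c * (swap x y * swap c d)).IsCycle := by
    intro x y hxy
    have hc := (List.isCycle_formPerm hxy (by simp)).conj (g := swap x y)
    have hcomm : swap x y * swap c d = swap c d * swap x y := by
      ext i
      simp only [Perm.mul_apply, swap_apply_def]
      grind
    convert hc using 1
    simpa [mul_assoc] using hcomm
  have hac : ∑ i, M i (swap a c i) ≤ r := by
    refine hneg _ ?_
    have := key b a (by simp; grind)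
    rwa [swap_comm b a] at this
  have hbc : ∑ i, M i (swap b c i) ≤ r := hneg _ (key a b (by simp; grind))
  have p1 := hpos _ (isThreeCycle_swap_mul_swap_same nab nac nbc).isCycle
  have p2 := hpos _ (isThreeCycle_swap_mul_swap_same nac nab (Ne.symm nbc)).isCycle
  linarith

open Equiv Equiv.Perm in
/-- A linear functional on permutation matrices which does not change sign strictly along the
pairs differing by a cycle does not change sign strictly at all. -/
theorem le_sum_perm_of_lt_sum_perm {α : Type*} [Fintype α] [DecidableEq α] (M : α → α → ℝ) (r : ℝ)
    (h : ∀ σ τ : Perm α, (σ⁻¹ * τ).IsCycle → r < ∑ i, M i (σ i) → r ≤ ∑ i, M i (τ i))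
    (σ τ : Perm α) (hσ : r < ∑ i, M i (σ i)) : r ≤ ∑ i, M i (τ i) := by
  induction hm : (σ⁻¹ * τ).support.card using Nat.strong_induction_on generalizing σ with
  | _ m ih =>
  subst hm
  by_contra! hτ
  obtain ⟨π, rfl⟩ : ∃ π, τ = σ * π := ⟨σ⁻¹ * τ, by simp⟩
  rw [inv_mul_cancel_left] at ih
  -- The new quotient `swap x (π x) * π` also fixes `x`, so its support is smaller.
  have hswap : ∀ x, π x ≠ x → ∑ i, M i (σ (swap x (π x) i)) ≤ r := by
    intro x hx
    by_contra! hlt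
    refine absurd hτ (not_lt.2 (ih _ ?_ (σ * swap x (π x)) hlt rfl))
    simpa [mul_assoc] using card_support_swap_mul hx
  obtain ⟨x, hx⟩ : ∃ x, π x ≠ x := by
    by_contra! hall
    obtain rfl : π = 1 := Equiv.ext hall
    simp only [mul_one] at hτ
    linarith
  obtain ⟨y, hy, hxy⟩ : ∃ y, π y ≠ y ∧ ¬ π.SameCycle x y := by
    by_contra! hall
    exact absurd hτ (not_lt.2 (h σ _ (by simpa using ⟨x, hx, fun y hy => hall y hy⟩) hσ))
  refine false_of_swap_le_of_disjoint (fun i j => M i (σ j)) r (a := x) (b := π x) (c := y)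
    (d := π y) ?_ ?_ hσ (hswap x hx) (hswap y hy)
  · intro ρ₁ ρ₂ hc hlt
    exact h (σ * ρ₁) (σ * ρ₂) (by simpa [mul_assoc] using hc) hlt
  · have h1 : x ≠ y := fun e => hxy (e ▸ SameCycle.refl _ _)
    have h2 : x ≠ π y := fun e => hxy (by
      have := SameCycle.refl π x
      nth_rw 2 [e] at this
      exact sameCycle_apply_right.1 this)
    have h3 : π x ≠ y := fun e => hxy (by
      rw [← e]
      exact sameCycle_apply_right.2 (SameCycle.refl _ _))
    have h4 : π x ≠ π y := fun e => h1 (π.injective e)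
    simp [hx.symm, hy.symm, h1, h2, h3, h4]

/-- The entries of a permutation matrix. -/
theorem permMatrix_apply_eq_ite {n : Type*} [DecidableEq n] (σ : Equiv.Perm n) (i j : n) :
    σ.permMatrix ℝ i j = if σ i = j then 1 else 0 := by
  simp [Equiv.Perm.permMatrix, PEquiv.toMatrix_apply, eq_comm]

/-- A linear functional on matrices, evaluated at a permutation matrix. -/
theorem map_permMatrix_eq_sum {n : Type*} [Fintype n] [DecidableEq n] (f : Matrix n n ℝ →ₗ[ℝ] ℝ)
    (σ : Equiv.Perm n) :
    f (σ.permMatrix ℝ) = ∑ i, f (Matrix.single i (σ i) 1) := by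
  conv_lhs => rw [Matrix.matrix_eq_sum_single (σ.permMatrix ℝ)]
  simp only [map_sum]
  refine Finset.sum_congr rfl fun i _ => ?_
  rw [Finset.sum_eq_single (σ i)]
  · simp
  · intro j _ hj
    simp [hj.symm]
  · simp

/-- If `σ` and `τ` differ by a cycle, then every doubly stochastic matrix supported in the union of
the supports of their permutation matrices lies on the line joining these matrices. -/
theorem exists_eq_combo_permMatrix_of_isCycle {n : Type*} [Fintype n] [DecidableEq n]
    {σ τ : Equiv.Perm n} (hc : (σ⁻¹ * τ).IsCycle) {X : Matrix n n ℝ}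
    (hX : X ∈ doublyStochastic ℝ n) (h0 : ∀ i j, σ i ≠ j → τ i ≠ j → X i j = 0) :
    ∃ t : ℝ, X = t • σ.permMatrix ℝ + (1 - t) • τ.permMatrix ℝ := by
  have hrow : ∀ i, σ i ≠ τ i → X i (σ i) + X i (τ i) = 1 := by
    intro i hi
    rw [← sum_row_of_mem_doublyStochastic hX i, ← Finset.sum_pair hi]
    refine Finset.sum_subset (Finset.subset_univ _) fun j _ hj => ?_
    simp only [Finset.mem_insert, Finset.mem_singleton, not_or] at hj
    exact h0 i j (Ne.symm hj.1) (Ne.symm hj.2)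
  have hrow' : ∀ i, σ i = τ i → X i (σ i) = 1 := by
    intro i hi
    rw [← sum_row_of_mem_doublyStochastic hX i, Finset.sum_eq_single (σ i)]
    · exact fun j _ hj => h0 i j hj.symm (hi ▸ hj.symm)
    · simp
  have hcol : ∀ i j, σ j = τ i → i ≠ j → X i (τ i) + X j (τ i) = 1 := by
    intro i j hj hij
    rw [← sum_col_of_mem_doublyStochastic hX (τ i), ← Finset.sum_pair (f := fun k => X k (τ i)) hij]
    refine Finset.sum_subset (Finset.subset_univ _) fun k _ hk => ?_
    simp only [Finset.mem_insert, Finset.mem_singleton, not_or] at hk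
    exact h0 k _ (fun e => hk.2 (σ.injective (e.trans hj.symm))) fun e => hk.1 (τ.injective e)
  -- Row `i` and column `τ i` share the entry `(i, τ i)`, and each has just one other possibly
  -- nonzero entry.
  have hinv : ∀ i, X ((σ⁻¹ * τ) i) (σ ((σ⁻¹ * τ) i)) = X i (σ i) := by
    intro i
    have hj : σ ((σ⁻¹ * τ) i) = τ i := by simp
    by_cases hi : σ i = τ i
    · have : (σ⁻¹ * τ) i = i := σ.injective (hj.trans hi.symm)
      rw [this]
    · have := hcol i _ hj fun e => hi (by rw [← hj, ← e])
      rw [hj]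
      linarith [hrow i hi]
  have hpow : ∀ (k : ℤ) i, X (((σ⁻¹ * τ) ^ k) i) (σ (((σ⁻¹ * τ) ^ k) i)) = X i (σ i) := by
    intro k
    induction k using Int.induction_on with
    | zero => simp
    | succ k ih =>
      intro i
      rw [zpow_add_one, Equiv.Perm.mul_apply, ih, hinv]
    | pred k ih =>
      intro i
      rw [zpow_sub_one, Equiv.Perm.mul_apply, ih, ← hinv ((σ⁻¹ * τ)⁻¹ i), ← Equiv.Perm.mul_apply,
        mul_inv_cancel, Equiv.Perm.one_apply]
  obtain ⟨x, -, hx⟩ := hc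
  have hconst : ∀ i, σ i ≠ τ i → X i (σ i) = X x (σ x) := by
    intro i hi
    obtain ⟨k, rfl⟩ := hx (y := i) fun e => hi (by
      conv_lhs => rw [← e]
      simp)
    exact hpow k x
  refine ⟨X x (σ x), ?_⟩
  ext i j
  simp only [Matrix.add_apply, Matrix.smul_apply, permMatrix_apply_eq_ite, smul_eq_mul]
  by_cases hi : σ i = τ i
  · by_cases hj : τ i = j
    · subst hj
      have := hrow' i hi
      rw [hi] at this
      simp [hi, this]
    · simp [hi, hj, h0 i j (hi ▸ hj) hj]
  · by_cases hj : σ i = j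
    · subst hj
      simp [Ne.symm hi, hconst i hi]
    · by_cases hj' : τ i = j
      · subst hj'
        simp [hi, ← hconst i hi]
        linarith [hrow i hi]
      · simp [hj, hj', h0 i j hj hj']

/-- A hyperplane that creates no new vertex in its upper half cannot strictly separate two
permutation matrices that differ by a cycle. -/
theorem le_map_permMatrix_of_isCycle {n : Type*} [Fintype n] [DecidableEq n]
    (f : Matrix n n ℝ →ₗ[ℝ] ℝ) (r : ℝ)
    (hf : ((doublyStochastic ℝ n : Set (Matrix n n ℝ)) ∩ {x | r ≤ f x}).extremePoints ℝ ⊆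
      (doublyStochastic ℝ n : Set (Matrix n n ℝ)).extremePoints ℝ)
    {σ τ : Equiv.Perm n} (hc : (σ⁻¹ * τ).IsCycle) (hσ : r < f (σ.permMatrix ℝ)) :
    r ≤ f (τ.permMatrix ℝ) := by
  by_contra! hτ
  set A := σ.permMatrix ℝ with hA
  set B := τ.permMatrix ℝ with hB
  have hAm : A ∈ doublyStochastic ℝ n := permMatrix_mem_doublyStochastic
  have hBm : B ∈ doublyStochastic ℝ n := permMatrix_mem_doublyStochastic
  obtain ⟨s, hs0, hs1, hs⟩ : ∃ s : ℝ, 0 < s ∧ s < 1 ∧ s * f A + (1 - s) * f B = r := by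
    have hd : 0 < f A - f B := by linarith
    refine ⟨(r - f B) / (f A - f B), div_pos (by linarith) hd, (div_lt_one hd).2 (by linarith), ?_⟩
    field_simp
    ring
  set z := s • A + (1 - s) • B with hz
  have hfz : f z = r := by simp [hz, ← hs]
  have hzm : z ∈ (doublyStochastic ℝ n : Set (Matrix n n ℝ)) :=
    convex_doublyStochastic hAm hBm hs0.le (by linarith) (by ring)
  have hz0 : ∀ i j, σ i ≠ j → τ i ≠ j → z i j = 0 := by
    intro i j h1 h2
    simp [hz, hA, hB, h1, h2]
  have hext : z ∈ ((doublyStochastic ℝ n : Set (Matrix n n ℝ)) ∩ {x | r ≤ f x}).extremePoints ℝ := by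
    rw [mem_extremePoints_iff_left]
    refine ⟨⟨hzm, hfz.ge⟩, ?_⟩
    rintro u ⟨hu, hfu⟩ v ⟨hv, hfv⟩ ⟨p, q, hp, hq, hpq, hzuv⟩
    simp only [Set.mem_ofPred_eq] at hfu hfv
    have hfu' : f u = r := by
      have h1 : p * f u + q * f v = r := by
        rw [← hfz, ← hzuv]
        simp
      have h2 : p * (f u - r) + q * (f v - r) = 0 := by
        have : r = (p + q) * r := by rw [hpq, one_mul]
        linarith
      have h3 := mul_nonneg hq.le (sub_nonneg.2 hfv)
      have h4 : p * (f u - r) ≤ p * 0 := by linarith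
      linarith [le_of_mul_le_mul_left h4 hp]
    -- By nonnegativity `u` vanishes wherever `z` does, so it lies on the line `AB`, which meets the
    -- hyperplane only at `z`.
    obtain ⟨t, ht⟩ := exists_eq_combo_permMatrix_of_isCycle hc hu fun i j h1 h2 => by
      have h3 : p * u i j + q * v i j = 0 := by
        rw [← hz0 i j h1 h2, ← hzuv]
        simp
      have h4 := mul_nonneg hq.le (nonneg_of_mem_doublyStochastic hv (i := i) (j := j))
      have h5 : p * u i j ≤ p * 0 := by linarith
      exact le_antisymm (le_of_mul_le_mul_left h5 hp) (nonneg_of_mem_doublyStochastic hu)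
    rw [← hA, ← hB] at ht
    have h1 : t * f A + (1 - t) * f B = r := by
      rw [← hfu', ht]
      simp
    have hts : t = s := by
      have h2 : (t - s) * (f A - f B) = 0 := by linear_combination h1 - hs
      rcases mul_eq_zero.1 h2 with h3 | h3 <;> linarith
    rw [ht, hts]
  have hAz := (mem_extremePoints_iff_left.1 (hf hext)).2 A hAm B hBm
    ⟨s, 1 - s, hs0, by linarith, by ring, rfl⟩
  rw [hAz] at hσ
  linarith

/-- A point of a set off its relative boundary can be reached by prolonging any segment that starts
in the set. -/
theorem exists_pos_add_smul_sub_mem_of_notMem_intrinsicFrontier {E : Type*} [AddCommGroup E]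
    [Module ℝ E] [TopologicalSpace E] [IsTopologicalAddGroup E] [ContinuousSMul ℝ E] {P : Set E}
    {x z : E} (hz : z ∈ P \ intrinsicFrontier ℝ P) (hx : x ∈ P) :
    ∃ t : ℝ, 0 < t ∧ z + t • (z - x) ∈ P := by
  have hzi : z ∈ intrinsicInterior ℝ P := by
    rw [← intrinsicClosure_sdiff_intrinsicFrontier]
    exact ⟨subset_intrinsicClosure hz.1, hz.2⟩
  obtain ⟨w, hw, rfl⟩ := mem_intrinsicInterior.1 hzi
  have hmem : ∀ t : ℝ, (w : E) + t • ((w : E) - x) ∈ affineSpan ℝ P := by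
    intro t
    have := (affineSpan ℝ P).smul_vsub_vadd_mem t w.2 (subset_affineSpan ℝ P hx) w.2
    simpa [add_comm] using this
  let γ : ℝ → affineSpan ℝ P := fun t => ⟨(w : E) + t • ((w : E) - x), hmem t⟩
  have hγ : Continuous γ := by
    refine Continuous.subtype_mk ?_ _
    fun_prop
  have hγ0 : γ 0 = w := Subtype.ext (by simp [γ])
  have hev : ∀ᶠ t in nhds (0 : ℝ), ((γ t : affineSpan ℝ P) : E) ∈ P :=
    hγ.continuousAt.eventually (by
      rw [hγ0]
      exact mem_interior_iff_mem_nhds.1 hw)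
  obtain ⟨t, ht, ht0⟩ := ((hev.filter_mono nhdsWithin_le_nhds).and
    (self_mem_nhdsWithin : Set.Ioi (0 : ℝ) ∈ nhdsWithin 0 (Set.Ioi 0))).exists
  exact ⟨t, ht0, ht⟩

/-- If a linear functional exceeds `r` at some doubly stochastic matrix, it does so at a permutation
matrix. -/
theorem exists_lt_map_permMatrix {n : Type*} [Fintype n] [DecidableEq n]
    (f : Matrix n n ℝ →ₗ[ℝ] ℝ) {r : ℝ} {X : Matrix n n ℝ} (hX : X ∈ doublyStochastic ℝ n)
    (hr : r < f X) : ∃ σ : Equiv.Perm n, r < f (σ.permMatrix ℝ) := by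
  by_contra! hall
  have hX' : X ∈ (doublyStochastic ℝ n : Set (Matrix n n ℝ)) := hX
  rw [doublyStochastic_eq_convexHull_permMatrix] at hX'
  have hsub := convexHull_min (s := {σ.permMatrix ℝ | σ : Equiv.Perm n}) (t := {x | f x ≤ r})
    (by rintro _ ⟨σ, rfl⟩; exact hall σ) (convex_halfSpace_le f.isLinear r)
  exact absurd (hsub hX') (not_le.2 hr)

theorem theorem3 (n : ℕ) :
    ¬ ∃ H : Set (Matrix (Fin n) (Fin n) ℝ), IsSeparatingHyperplane (birkhoffPolytope n) H := by
  rintro ⟨_, f, r, -, rfl, ⟨z, hzr, hz⟩, hP, hext, -⟩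
  simp only [Set.mem_ofPred_eq] at hzr
  obtain ⟨x, hx, hxr⟩ := Set.not_subset.1 hP
  simp only [Set.mem_ofPred_eq] at hxr
  -- Prolonging from `x` past `z` reaches the other side of the hyperplane.
  obtain ⟨t, ht, hy⟩ := exists_pos_add_smul_sub_mem_of_notMem_intrinsicFrontier hz hx
  have hfy : f (z + t • (z - x)) = r + t * (r - f x) := by simp [hzr]
  obtain ⟨⟨X, hX, hXr⟩, Y, hY, hYr⟩ : (∃ X ∈ birkhoffPolytope n, r < f X) ∧
      ∃ Y ∈ birkhoffPolytope n, f Y < r := by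
    rcases lt_or_gt_of_ne hxr with hlt | hgt
    · refine ⟨⟨_, hy, ?_⟩, x, hx, hlt⟩
      rw [hfy]
      linarith [mul_pos ht (sub_pos.2 hlt)]
    · refine ⟨⟨x, hx, hgt⟩, _, hy, ?_⟩
      rw [hfy]
      linarith [mul_pos ht (sub_pos.2 hgt)]
  obtain ⟨σ, hσ⟩ := exists_lt_map_permMatrix f hX hXr
  obtain ⟨τ, hτ⟩ := exists_lt_map_permMatrix (-f) (r := -r) hY (by simpa using hYr)
  rw [LinearMap.neg_apply, neg_lt_neg_iff, map_permMatrix_eq_sum] at hτ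
  rw [map_permMatrix_eq_sum] at hσ
  refine absurd hτ (not_lt.2 (le_sum_perm_of_lt_sum_perm (fun i j => f (Matrix.single i j 1)) r
    (fun ρ₁ ρ₂ hc hlt => ?_) σ τ hσ))
  rw [← map_permMatrix_eq_sum] at hlt ⊢
  exact le_map_permMatrix_of_isCycle f r hext hc hlt
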